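/- For positive integers $m,n,d$, a linear map $\mathcal{A}:\mathbb{R}^{m\times n}\to\mathbb{R}^{d}$ and an integer $r\ge 1$, let $\delta_r(\mathcal{A})$ be the $r$-restricted isometry constant of $\mathcal{A}$, i.e. the smallest number $\delta$ such that $$(1-\delta)\|X\|_F^2\le\|\mathcal{A}(X)\|_2^2\le(1+\delta)\|X\|_F^2$$ for all $X\in\mathbb{R}^{m\times n}$ of rank at most $r$. For $a>0$ let $$P_a(X)=\sum_{i=1}^{m}\frac{a\,\sigma_i(X)}{a\,\sigma_i(X)+1},$$ where $\sigma_1(X)\ge\sigma_2(X)\ge\dots\ge 0$ are the singular values of $X$ (with $\sigma_i(X)=0$ for $i>\min(m,n)$). For $b\in\mathbb{R}^d$ consider the problems $$(\mathrm{AMRM})\quad \min_{X\in\mathbb{R}^{m\times n}}\operatorname{rank}(X)\ \text{ s.t. } \mathcal{A}(X)=b,\qquad\qquad (\mathrm{TrAMRM})\quad \min_{X\in\mathbb{R}^{m\times n}}P_a(X)\ \text{ s.t. } \mathcal{A}(X)=b.$$ **Theorem.** Let $T\ge 1$ and $K>2T$ be integers and let $\delta',\delta''$ be real numbers with $$\frac{K}{2T}\,(1-\delta'')-(1+\delta')>0.$$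 Then there is a number $a^*>1$, depending only on $T,K,\delta',\delta''$, such that the following holds for all $m,n,d$, every linear map $\mathcal{A}:\mathbb{R}^{m\times n}\to\mathbb{R}^d$ with $\delta_K(\mathcal{A})=\delta'$ and $\delta_{2T+K}(\mathcal{A})=\delta''$, and every $b\in\mathbb{R}^d$: if $X_0$ is an optimal solution of (AMRM) with $\operatorname{rank}(X_0)=T$, and $X^*$ is an optimal solution of (TrAMRM) for some $a$ with $1<a<a^*$, then $X^*=X_0$. -/

import Mathlib

namespace TrAMRM

/-- The fraction function `ρ_a(t) = a|t| / (a|t| + 1)`. -/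
noncomputable def fractionFun (a t : ℝ) : ℝ := a * |t| / (a * |t| + 1)

/-- The singular values `σ₀(X) ≥ σ₁(X) ≥ ⋯ ≥ 0` of a real matrix, repeated according to multiplicity
and counted from `0`; they are `0` from the index `min m n` on. -/
noncomputable def singularValue {m n : ℕ} (X : Matrix (Fin m) (Fin n) ℝ) (i : ℕ) : ℝ :=
  (Matrix.toEuclideanLin X).singularValues i

/-- `P_a(X)`, the sum of `ρ_a` over the `m` singular values of the `m × n` matrix `X`. -/
noncomputable def penalty {m n : ℕ} (a : ℝ) (X : Matrix (Fin m) (Fin n) ℝ) : ℝ :=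
  ∑ i ∈ Finset.range m, fractionFun a (singularValue X i)

/-- The squared Frobenius norm. -/
def frobeniusSq {m n : ℕ} (X : Matrix (Fin m) (Fin n) ℝ) : ℝ := ∑ i, ∑ j, X i j ^ 2

/-- `X` is an optimal solution of: minimize `rank X` subject to `𝒜 X = b`. -/
def IsAMRMSolution {m n d : ℕ}
    (𝒜 : Matrix (Fin m) (Fin n) ℝ →ₗ[ℝ] EuclideanSpace ℝ (Fin d)) (b : EuclideanSpace ℝ (Fin d))
    (X : Matrix (Fin m) (Fin n) ℝ) : Prop :=
  𝒜 X = b ∧ ∀ Y : Matrix (Fin m) (Fin n) ℝ, 𝒜 Y = b → X.rank ≤ Y.rank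

/-- `X` is an optimal solution of: minimize `P_a(X)` subject to `𝒜 X = b`. -/
def IsTrAMRMSolution {m n d : ℕ}
    (𝒜 : Matrix (Fin m) (Fin n) ℝ →ₗ[ℝ] EuclideanSpace ℝ (Fin d)) (b : EuclideanSpace ℝ (Fin d))
    (a : ℝ) (X : Matrix (Fin m) (Fin n) ℝ) : Prop :=
  𝒜 X = b ∧ ∀ Y : Matrix (Fin m) (Fin n) ℝ, 𝒜 Y = b → penalty a X ≤ penalty a Y

/-- The numbers `δ` with `(1 - δ)‖X‖_F² ≤ ‖𝒜 X‖₂² ≤ (1 + δ)‖X‖_F²` for all `X` of rank at most `r`. -/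
def ricSet {m n d : ℕ}
    (𝒜 : Matrix (Fin m) (Fin n) ℝ →ₗ[ℝ] EuclideanSpace ℝ (Fin d)) (r : ℕ) : Set ℝ :=
  {δ | ∀ X : Matrix (Fin m) (Fin n) ℝ, X.rank ≤ r →
    (1 - δ) * frobeniusSq X ≤ ‖𝒜 X‖ ^ 2 ∧ ‖𝒜 X‖ ^ 2 ≤ (1 + δ) * frobeniusSq X}

/-- The `r`-restricted isometry constant `δ_r(𝒜)`: the smallest element of `ricSet 𝒜 r`
(see `isLeast_ric`). -/
noncomputable def ric {m n d : ℕ}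
    (𝒜 : Matrix (Fin m) (Fin n) ℝ →ₗ[ℝ] EuclideanSpace ℝ (Fin d)) (r : ℕ) : ℝ :=
  sInf (ricSet 𝒜 r)

theorem frobeniusSq_nonneg {m n : ℕ} (X : Matrix (Fin m) (Fin n) ℝ) : 0 ≤ frobeniusSq X :=
  Finset.sum_nonneg fun _ _ => Finset.sum_nonneg fun _ _ => sq_nonneg _

theorem ricSet_nonempty {m n d : ℕ}
    (𝒜 : Matrix (Fin m) (Fin n) ℝ →ₗ[ℝ] EuclideanSpace ℝ (Fin d)) (r : ℕ) :
    (ricSet 𝒜 r).Nonempty := by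
  obtain ⟨C, hC0, hC⟩ : ∃ C : ℝ, 0 ≤ C ∧
      ∀ X : Matrix (Fin m) (Fin n) ℝ, ‖𝒜 X‖ ^ 2 ≤ C * frobeniusSq X := by
    let c : Fin m × Fin n → ℝ := fun p => ‖𝒜 (Matrix.single p.1 p.2 1)‖
    refine ⟨∑ p, c p ^ 2, Finset.sum_nonneg fun _ _ => sq_nonneg _, fun X => ?_⟩
    have h1 : ‖𝒜 X‖ ≤ ∑ p : Fin m × Fin n, c p * |X p.1 p.2| := by
      have hX : 𝒜 X = ∑ p : Fin m × Fin n, X p.1 p.2 • 𝒜 (Matrix.single p.1 p.2 1) := by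
        conv_lhs => rw [Matrix.matrix_eq_sum_single X]
        rw [Fintype.sum_prod_type]
        simp only [map_sum]
        refine Finset.sum_congr rfl fun i _ => Finset.sum_congr rfl fun j _ => ?_
        rw [← map_smul, Matrix.smul_single, smul_eq_mul, mul_one]
      rw [hX]
      refine (norm_sum_le _ _).trans (Finset.sum_le_sum fun p _ => ?_)
      rw [norm_smul, Real.norm_eq_abs, mul_comm]
    have h2 : frobeniusSq X = ∑ p : Fin m × Fin n, |X p.1 p.2| ^ 2 := by
      simp only [frobeniusSq, sq_abs, Fintype.sum_prod_type]
    rw [h2]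
    exact (pow_le_pow_left₀ (norm_nonneg _) h1 2).trans (Finset.sum_mul_sq_le_sq_mul_sq _ _ _)
  refine ⟨C + 1, fun X _ => ⟨?_, ?_⟩⟩
  · nlinarith [sq_nonneg ‖𝒜 X‖, frobeniusSq_nonneg X]
  · nlinarith [hC X, frobeniusSq_nonneg X]

/-- For `r ≥ 1` and nonempty matrices the smallest number in the definition of `δ_r(𝒜)` exists. -/
theorem isLeast_ric {m n d : ℕ} (hm : 0 < m) (hn : 0 < n)
    (𝒜 : Matrix (Fin m) (Fin n) ℝ →ₗ[ℝ] EuclideanSpace ℝ (Fin d)) {r : ℕ} (hr : 1 ≤ r) :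
    IsLeast (ricSet 𝒜 r) (ric 𝒜 r) := by
  have hbdd : BddBelow (ricSet 𝒜 r) := by
    refine ⟨0, fun δ hδ => ?_⟩
    have hpos : frobeniusSq (Matrix.single (⟨0, hm⟩ : Fin m) (⟨0, hn⟩ : Fin n) (1 : ℝ)) = 1 := by
      simp [frobeniusSq, Matrix.single_apply, ite_and]
    have hrk : (Matrix.single (⟨0, hm⟩ : Fin m) (⟨0, hn⟩ : Fin n) (1 : ℝ)).rank ≤ r := by
      rw [Matrix.single_eq_single_vecMulVec_single]
      exact (Matrix.rank_vecMulVec_le _ _).trans hr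
    have h := hδ _ hrk
    rw [hpos] at h
    linarith [h.1, h.2]
  have hclosed : IsClosed (ricSet 𝒜 r) := by
    have h : ricSet 𝒜 r = ⋂ (X : Matrix (Fin m) (Fin n) ℝ) (_ : X.rank ≤ r),
        ({δ : ℝ | (1 - δ) * frobeniusSq X ≤ ‖𝒜 X‖ ^ 2} ∩
          {δ : ℝ | ‖𝒜 X‖ ^ 2 ≤ (1 + δ) * frobeniusSq X}) := by
      ext δ
      simp [ricSet]
    rw [h]
    refine isClosed_iInter fun X => isClosed_iInter fun _ => ?_
    exact (isClosed_le (by fun_prop) continuous_const).inter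
      (isClosed_le continuous_const (by fun_prop))
  exact hclosed.isLeast_csInf (ricSet_nonempty 𝒜 r) hbdd

end TrAMRM

/-!
Write `R = X₀ - X*`, an element of the kernel of `𝒜`, with singular values `s₀ ≥ s₁ ≥ ⋯`, and
`f = ρ_a`. The proof compares the leading `2T` singular values of `R` with the others.

The partial sums `∑_{i < k} f(σᵢ)` are subadditive (`sum_fractionFun_singularValue_add_le`). As `f`
is a mixture of the functions `min · c` and a linear function (`fractionFun_eq_integral`), this
reduces to the sums `∑_{i < k} min(σᵢ, c)`
(`LinearMap.sum_min_singularValues_add_le`), where the singular values above `c` are removed at a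
cost of `c` per rank (Weyl) and the rest is bounded by Ky Fan's inequality. For `k = T` this gives
`P_a(X₀) ≤ ∑_{i < T} f(σᵢ(X*)) + ∑_{i < T} f(sᵢ)`. Optimality of `X*` turns it into
`∑_{i ≥ T} f(σᵢ(X*)) ≤ ∑_{i < T} f(sᵢ)`, and Weyl's inequality `s_{i+T} ≤ σᵢ(X*)` into
`∑_{i ≥ 2T} f(sᵢ) ≤ ∑_{i < 2T} f(sᵢ)` (`sum_tail_fractionFun_le_of_penalty_le`).

Because `f(t) / t` decreases, the same inequality holds without `f`
(`sum_tail_le_sum_head_of_fractionFun`). This is where the dependence on `a` disappears: the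
conclusion holds for every `a > 0`. The usual block argument with the restricted isometry constants
then forces `R = 0` (`eq_zero_of_sum_tail_le_sum_head`).
-/

open Module

/-! ### Singular vectors and Weyl's inequality -/

section SingularValueDecomposition

variable {E F : Type*} [NormedAddCommGroup E] [InnerProductSpace ℝ E] [FiniteDimensional ℝ E]
  [NormedAddCommGroup F] [InnerProductSpace ℝ F] [FiniteDimensional ℝ F]

/-- A family of vectors that satisfies Bessel's inequality. -/
def IsBessel {G : Type*} [NormedAddCommGroup G] [InnerProductSpace ℝ G] (u : ℕ → G) : Prop :=
  ∀ (s : Finset ℕ) (x : G), ∑ i ∈ s, inner ℝ (u i) x ^ 2 ≤ ‖x‖ ^ 2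

theorem isBessel_of_orthogonal {G : Type*} [NormedAddCommGroup G] [InnerProductSpace ℝ G]
    {u : ℕ → G} (h1 : ∀ i, ‖u i‖ ≤ 1) (h2 : ∀ i j, i ≠ j → inner ℝ (u i) (u j) = 0) :
    IsBessel u := by
  intro s x
  have hy : ‖∑ i ∈ s, inner ℝ (u i) x • u i‖ ^ 2 = ∑ i ∈ s, inner ℝ (u i) x ^ 2 * ‖u i‖ ^ 2 := by
    rw [← real_inner_self_eq_norm_sq, sum_inner]
    refine Finset.sum_congr rfl fun i hi => ?_
    rw [inner_sum, Finset.sum_eq_single i]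
    · rw [real_inner_smul_left, real_inner_smul_right, real_inner_self_eq_norm_sq]; ring
    · intro j _ hj
      rw [real_inner_smul_left, real_inner_smul_right, h2 i j hj.symm]; ring
    · exact fun h => absurd hi h
  have hxy : inner ℝ x (∑ i ∈ s, inner ℝ (u i) x • u i) = ∑ i ∈ s, inner ℝ (u i) x ^ 2 := by
    rw [inner_sum]
    refine Finset.sum_congr rfl fun i _ => ?_
    rw [real_inner_smul_right, real_inner_comm]; ring
  have h := norm_sub_sq_real x (∑ i ∈ s, inner ℝ (u i) x • u i)
  have hle : ∑ i ∈ s, inner ℝ (u i) x ^ 2 * ‖u i‖ ^ 2 ≤ ∑ i ∈ s, inner ℝ (u i) x ^ 2 := by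
    refine Finset.sum_le_sum fun i _ => mul_le_of_le_one_right (sq_nonneg _) ?_
    exact pow_le_one₀ (norm_nonneg _) (h1 i)
  rw [hy, hxy] at h
  nlinarith [sq_nonneg ‖x - ∑ i ∈ s, inner ℝ (u i) x • u i‖]

theorem IsBessel.norm_sq_le_one {G : Type*} [NormedAddCommGroup G] [InnerProductSpace ℝ G]
    {u : ℕ → G} (h : IsBessel u) (i : ℕ) : ‖u i‖ ^ 2 ≤ 1 := by
  have h1 := h {i} (u i)
  rw [Finset.sum_singleton, real_inner_self_eq_norm_sq] at h1
  by_contra! h2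
  nlinarith

namespace LinearMap

variable (L : E →ₗ[ℝ] F)

/-- The right singular vectors of `L`, ordered as `L.singularValues`: an orthonormal basis of the
domain, continued by `0` from the index `finrank ℝ E` on. -/
noncomputable def rightSingularVector (i : ℕ) : E :=
  if h : i < finrank ℝ E then L.isSymmetric_adjoint_comp_self.eigenvectorBasis rfl ⟨i, h⟩ else 0

/-- The left singular vectors of `L`, taken to be `0` where the singular value is `0`. -/
noncomputable def leftSingularVector (i : ℕ) : F :=
  (L.singularValues i)⁻¹ • L (L.rightSingularVector i)

/-- The part of the singular value decomposition of `L` that belongs to the indices in `S`. -/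
noncomputable def svdPart (S : Finset ℕ) : E →ₗ[ℝ] F :=
  ∑ i ∈ S, (innerₛₗ ℝ (L.rightSingularVector i)).smulRight (L (L.rightSingularVector i))

theorem svdPart_apply (S : Finset ℕ) (x : E) :
    L.svdPart S x =
      ∑ i ∈ S, inner ℝ (L.rightSingularVector i) x • L (L.rightSingularVector i) := by
  simp [svdPart]

theorem rightSingularVector_fin (i : Fin (finrank ℝ E)) :
    L.rightSingularVector i = L.isSymmetric_adjoint_comp_self.eigenvectorBasis rfl i := by
  simp [rightSingularVector]

theorem rightSingularVector_of_le {i : ℕ} (h : finrank ℝ E ≤ i) : L.rightSingularVector i = 0 := by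
  simp [rightSingularVector, not_lt.mpr h]

theorem inner_rightSingularVector (i j : ℕ) :
    inner ℝ (L.rightSingularVector i) (L.rightSingularVector j) =
      if i = j ∧ i < finrank ℝ E then 1 else 0 := by
  by_cases hi : i < finrank ℝ E
  · by_cases hj : j < finrank ℝ E
    · have h := orthonormal_iff_ite.mp
        (L.isSymmetric_adjoint_comp_self.eigenvectorBasis rfl).orthonormal ⟨i, hi⟩ ⟨j, hj⟩
      rw [← rightSingularVector_fin, ← rightSingularVector_fin] at h
      simpa [hi] using h
    · have : ¬ (i = j ∧ i < finrank ℝ E) := by omega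
      rw [L.rightSingularVector_of_le (not_lt.mp hj), inner_zero_right, if_neg this]
  · rw [L.rightSingularVector_of_le (not_lt.mp hi), inner_zero_left, if_neg (fun h => hi h.2)]

theorem isBessel_rightSingularVector : IsBessel L.rightSingularVector := by
  refine isBessel_of_orthogonal (fun i => ?_) (fun i j hij => ?_)
  · have h := L.inner_rightSingularVector i i
    rw [real_inner_self_eq_norm_sq] at h
    refine (sq_le_one_iff₀ (norm_nonneg _)).mp ?_
    rw [h]; split_ifs <;> norm_num
  · rw [inner_rightSingularVector, if_neg (fun h => hij h.1)]

theorem sum_range_rightSingularVector {G : Type*} [AddCommMonoid G] (g : E → G) :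
    ∑ i ∈ Finset.range (finrank ℝ E), g (L.rightSingularVector i) =
      ∑ i, g (L.isSymmetric_adjoint_comp_self.eigenvectorBasis rfl i) := by
  rw [Finset.sum_range]
  exact Finset.sum_congr rfl fun i _ => by rw [rightSingularVector_fin]

theorem sum_inner_rightSingularVector_smul (x : E) :
    ∑ i ∈ Finset.range (finrank ℝ E),
      inner ℝ (L.rightSingularVector i) x • L.rightSingularVector i = x := by
  rw [L.sum_range_rightSingularVector (fun v => inner ℝ v x • v)]
  exact (L.isSymmetric_adjoint_comp_self.eigenvectorBasis rfl).sum_repr' x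

theorem sum_sq_inner_rightSingularVector (x : E) :
    ∑ i ∈ Finset.range (finrank ℝ E), inner ℝ (L.rightSingularVector i) x ^ 2 = ‖x‖ ^ 2 := by
  rw [L.sum_range_rightSingularVector (fun v => inner ℝ v x ^ 2)]
  exact (L.isSymmetric_adjoint_comp_self.eigenvectorBasis rfl).sum_sq_inner_right x

theorem inner_apply_rightSingularVector (i j : ℕ) :
    inner ℝ (L (L.rightSingularVector i)) (L (L.rightSingularVector j)) =
      if i = j then L.singularValues i ^ 2 else 0 := by
  by_cases hj : j < finrank ℝ E
  · have h : adjoint L (L (L.rightSingularVector j)) =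
        L.singularValues j ^ 2 • L.rightSingularVector j := by
      have h1 := L.isSymmetric_adjoint_comp_self.apply_eigenvectorBasis rfl ⟨j, hj⟩
      rw [← rightSingularVector_fin, ← L.sq_singularValues_fin rfl] at h1
      simpa using h1
    rw [← adjoint_inner_right, h, real_inner_smul_right, inner_rightSingularVector]
    by_cases hij : i = j
    · subst hij; simp [hj]
    · simp [hij]
  · rw [L.rightSingularVector_of_le (not_lt.mp hj), map_zero, inner_zero_right]
    split_ifs with hij
    · rw [hij, L.singularValues_of_finrank_le (not_lt.mp hj)]; simp
    · rfl

theorem norm_apply_rightSingularVector (i : ℕ) :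
    ‖L (L.rightSingularVector i)‖ = L.singularValues i := by
  have h := L.inner_apply_rightSingularVector i i
  rw [real_inner_self_eq_norm_sq, if_pos rfl] at h
  exact (sq_eq_sq₀ (norm_nonneg _) (L.singularValues_nonneg i)).mp h

theorem singularValues_smul_leftSingularVector (i : ℕ) :
    L.singularValues i • L.leftSingularVector i = L (L.rightSingularVector i) := by
  rw [leftSingularVector, smul_smul]
  by_cases h : L.singularValues i = 0
  · have h1 := L.norm_apply_rightSingularVector i
    rw [h, norm_eq_zero] at h1
    rw [h1, smul_zero]
  · rw [mul_inv_cancel₀ h, one_smul]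

theorem isBessel_leftSingularVector : IsBessel L.leftSingularVector := by
  refine isBessel_of_orthogonal (fun i => ?_) (fun i j hij => ?_)
  · rw [leftSingularVector, norm_smul, norm_apply_rightSingularVector, norm_inv,
      Real.norm_of_nonneg (L.singularValues_nonneg i)]
    exact inv_mul_le_one
  · rw [leftSingularVector, leftSingularVector, real_inner_smul_left, real_inner_smul_right,
      inner_apply_rightSingularVector, if_neg hij]
    ring

theorem inner_leftSingularVector_apply (i : ℕ) :
    inner ℝ (L.leftSingularVector i) (L (L.rightSingularVector i)) = L.singularValues i := by
  rw [leftSingularVector, real_inner_smul_left, inner_apply_rightSingularVector, if_pos rfl]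
  by_cases h : L.singularValues i = 0
  · simp [h]
  · field_simp

theorem svdPart_range {N : ℕ} (hN : finrank ℝ E ≤ N) : L.svdPart (Finset.range N) = L := by
  ext x
  rw [svdPart_apply]
  conv_rhs => rw [← L.sum_inner_rightSingularVector_smul x, map_sum]
  refine (Finset.sum_subset (Finset.range_mono hN) fun i _ hi => ?_).symm.trans ?_
  · rw [L.rightSingularVector_of_le (by simpa using hi)]; simp
  · simp

theorem svdPart_rightSingularVector (S : Finset ℕ) (i : ℕ) :
    L.svdPart S (L.rightSingularVector i) = if i ∈ S then L (L.rightSingularVector i) else 0 := by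
  rw [svdPart_apply]
  simp only [inner_rightSingularVector, ite_smul, one_smul, zero_smul]
  by_cases hi : i < finrank ℝ E
  · rw [← Finset.sum_ite_eq' S i fun j => L (L.rightSingularVector j)]
    refine Finset.sum_congr rfl fun j _ => ?_
    by_cases hj : j = i
    · simp [hj, hi]
    · simp [hj]
  · rw [L.rightSingularVector_of_le (not_lt.mp hi), map_zero, ite_self]
    refine Finset.sum_eq_zero fun j _ => ?_
    rw [if_neg (by rintro ⟨rfl, h⟩; exact hi h)]

theorem finrank_range_svdPart_le (S : Finset ℕ) : finrank ℝ (L.svdPart S).range ≤ S.card := by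
  classical
  have h : (L.svdPart S).range ≤
      Submodule.span ℝ (S.image fun i => L (L.rightSingularVector i) : Finset F) := by
    rintro _ ⟨x, rfl⟩
    rw [svdPart_apply]
    refine Submodule.sum_mem _ fun i hi => Submodule.smul_mem _ _ (Submodule.subset_span ?_)
    exact Finset.mem_coe.mpr (Finset.mem_image_of_mem _ hi)
  exact (Submodule.finrank_mono h).trans ((finrank_span_finset_le_card _).trans
    Finset.card_image_le)

theorem norm_apply_sq (x : E) :
    ‖L x‖ ^ 2 = ∑ i ∈ Finset.range (finrank ℝ E),
      L.singularValues i ^ 2 * inner ℝ (L.rightSingularVector i) x ^ 2 := by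
  conv_lhs => rw [← L.svdPart_range le_rfl, svdPart_apply]
  rw [← real_inner_self_eq_norm_sq, sum_inner]
  refine Finset.sum_congr rfl fun i hi => ?_
  rw [inner_sum, Finset.sum_eq_single i]
  · rw [real_inner_smul_left, real_inner_smul_right, inner_apply_rightSingularVector, if_pos rfl]
    ring
  · intro j _ hj
    rw [real_inner_smul_left, real_inner_smul_right, inner_apply_rightSingularVector,
      if_neg hj.symm]
    ring
  · exact fun h => absurd hi h

/-- Weyl's inequality for perturbations of rank at most `k`, for operators `A` and `C` that are only
compared on the kernel of an operator `Y` of rank at most `k` (such as `C - A`). -/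
theorem singularValues_le_of_forall_apply_eq_zero {A C Y : E →ₗ[ℝ] F} {k : ℕ}
    (hY : finrank ℝ Y.range ≤ k) (hCA : ∀ x, Y x = 0 → ‖C x‖ ≤ ‖A x‖) (i : ℕ) :
    C.singularValues (i + k) ≤ A.singularValues i := by
  by_cases hn : i + k < finrank ℝ E
  swap
  · rw [C.singularValues_of_finrank_le (not_lt.mp hn)]
    exact A.singularValues_nonneg i
  -- A vector in the span of the first `i + k + 1` right singular vectors of `C` that `Y` kills
  -- and that is orthogonal to the first `i` right singular vectors of `A`.
  let comb : (Fin (i + k + 1) → ℝ) →ₗ[ℝ] E :=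
    Fintype.linearCombination ℝ fun j : Fin (i + k + 1) => C.rightSingularVector j
  let Φ : (Fin (i + k + 1) → ℝ) →ₗ[ℝ] Y.range × (Fin i → ℝ) :=
    (Y.rangeRestrict.prod (LinearMap.pi fun j : Fin i => innerₛₗ ℝ (A.rightSingularVector j))) ∘ₗ
      comb
  have hdim : finrank ℝ (Y.range × (Fin i → ℝ)) < finrank ℝ (Fin (i + k + 1) → ℝ) := by
    rw [Module.finrank_prod, Module.finrank_fin_fun, Module.finrank_fin_fun]
    omega
  obtain ⟨c, hcker, hc0⟩ := Submodule.exists_mem_ne_zero_of_ne_bot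
    (LinearMap.ker_ne_bot_of_finrank_lt (f := Φ) hdim)
  set x := comb c with hx
  have hΦ : Φ c = 0 := hcker
  have hYx : Y x = 0 := congrArg (fun p => (p.1 : F)) hΦ
  have hAx : ∀ j < i, inner ℝ (A.rightSingularVector j) x = 0 := fun j hj =>
    congrFun (congrArg Prod.snd hΦ) ⟨j, hj⟩
  have hxs : x = ∑ j : Fin (i + k + 1), c j • C.rightSingularVector j := by
    rw [hx]; exact Fintype.linearCombination_apply ℝ _ _
  have hCx : ∀ l, inner ℝ (C.rightSingularVector l) x =
      if h : l < i + k + 1 then c ⟨l, h⟩ else 0 := by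
    intro l
    rw [hxs, inner_sum]
    simp only [real_inner_smul_right, inner_rightSingularVector]
    split_ifs with h
    · rw [Finset.sum_eq_single ⟨l, h⟩]
      · simp; omega
      · intro j _ hj
        rw [if_neg, mul_zero]
        rintro ⟨rfl, _⟩
        exact hj rfl
      · simp
    · refine Finset.sum_eq_zero fun j _ => ?_
      rw [if_neg, mul_zero]
      rintro ⟨rfl, _⟩
      exact h j.2
  have hx0 : x ≠ 0 := by
    intro h0
    refine hc0 (funext fun j => ?_)
    have h := hCx j
    rw [h0, inner_zero_right, dif_pos j.2] at h
    exact h.symm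
  have hlow : C.singularValues (i + k) ^ 2 * ‖x‖ ^ 2 ≤ ‖C x‖ ^ 2 := by
    rw [C.norm_apply_sq, ← C.sum_sq_inner_rightSingularVector, Finset.mul_sum]
    refine Finset.sum_le_sum fun l _ => ?_
    by_cases hl : l < i + k + 1
    · exact mul_le_mul_of_nonneg_right (pow_le_pow_left₀ (C.singularValues_nonneg _)
        (C.singularValues_antitone (by omega)) 2) (sq_nonneg _)
    · rw [hCx, dif_neg hl]; simp
  have hup : ‖A x‖ ^ 2 ≤ A.singularValues i ^ 2 * ‖x‖ ^ 2 := by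
    rw [A.norm_apply_sq, ← A.sum_sq_inner_rightSingularVector, Finset.mul_sum]
    refine Finset.sum_le_sum fun l _ => ?_
    by_cases hl : l < i
    · rw [hAx l hl]; simp
    · exact mul_le_mul_of_nonneg_right (pow_le_pow_left₀ (A.singularValues_nonneg _)
        (A.singularValues_antitone (by omega)) 2) (sq_nonneg _)
  have hle : ‖C x‖ ^ 2 ≤ ‖A x‖ ^ 2 := pow_le_pow_left₀ (norm_nonneg _) (hCA x hYx) 2
  have hpos : 0 < ‖x‖ ^ 2 := pow_pos (norm_pos_iff.mpr hx0) 2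
  exact (sq_le_sq₀ (C.singularValues_nonneg _) (A.singularValues_nonneg _)).mp
    (le_of_mul_le_mul_right (hlow.trans (hle.trans hup)) hpos)

end LinearMap

end SingularValueDecomposition

/-! ### Ky Fan's inequality and truncated sums of singular values -/

section KyFan

variable {E F : Type*} [NormedAddCommGroup E] [InnerProductSpace ℝ E] [FiniteDimensional ℝ E]
  [NormedAddCommGroup F] [InnerProductSpace ℝ F] [FiniteDimensional ℝ F]

/-- A weighted sum of a decreasing sequence, with weights in `[0, 1]` of total mass at most `k`, is
at most the sum of the first `k` terms. -/
theorem sum_mul_le_sum_Ico_of_antitone {s w : ℕ → ℝ} (hs : Antitone s) (hs0 : ∀ i, 0 ≤ s i)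
    {r k N : ℕ} (hw0 : ∀ i, 0 ≤ w i) (hw1 : ∀ i, w i ≤ 1)
    (hw : ∑ j ∈ Finset.Ico r (r + k + N), w j ≤ k) :
    ∑ j ∈ Finset.Ico r (r + k + N), s j * w j ≤ ∑ j ∈ Finset.Ico r (r + k), s j := by
  rw [← Finset.sum_Ico_consecutive _ (show r ≤ r + k by omega)
    (show r + k ≤ r + k + N by omega)] at hw ⊢
  have h1 : ∑ j ∈ Finset.Ico r (r + k), s j * w j ≤
      ∑ j ∈ Finset.Ico r (r + k), (s j - s (r + k) + s (r + k) * w j) := by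
    refine Finset.sum_le_sum fun j hj => ?_
    have : s (r + k) ≤ s j := hs (Finset.mem_Ico.mp hj).2.le
    nlinarith [hw1 j]
  have h2 : ∑ j ∈ Finset.Ico (r + k) (r + k + N), s j * w j ≤
      ∑ j ∈ Finset.Ico (r + k) (r + k + N), s (r + k) * w j :=
    Finset.sum_le_sum fun j hj =>
      mul_le_mul_of_nonneg_right (hs (Finset.mem_Ico.mp hj).1) (hw0 j)
  rw [Finset.sum_add_distrib, Finset.sum_sub_distrib, ← Finset.mul_sum, Finset.sum_const,
    Nat.card_Ico, Nat.add_sub_cancel_left, nsmul_eq_mul] at h1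
  rw [← Finset.mul_sum] at h2
  nlinarith [hs0 (r + k)]

theorem IsBessel.sum_sum_sq_inner_le {G : Type*} [NormedAddCommGroup G] [InnerProductSpace ℝ G]
    {x y : ℕ → G} (hx : IsBessel x) (hy : IsBessel y) (S : Finset ℕ) (k : ℕ) :
    ∑ j ∈ S, ∑ i ∈ Finset.range k, inner ℝ (x i) (y j) ^ 2 ≤ k := by
  rw [Finset.sum_comm]
  calc ∑ i ∈ Finset.range k, ∑ j ∈ S, inner ℝ (x i) (y j) ^ 2
      ≤ ∑ i ∈ Finset.range k, (1 : ℝ) := by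
        refine Finset.sum_le_sum fun i _ => le_trans ?_ (hx.norm_sq_le_one i)
        simpa only [real_inner_comm] using hy S (x i)
    _ = k := by simp

/-- Ky Fan's inequality for the tail of a singular value decomposition. -/
theorem LinearMap.sum_inner_svdPart_le (L : E →ₗ[ℝ] F) {u : ℕ → F} {v : ℕ → E} (hu : IsBessel u)
    (hv : IsBessel v) (r k N : ℕ) :
    ∑ i ∈ Finset.range k, inner ℝ (u i) (L.svdPart (Finset.Ico r (r + k + N)) (v i)) ≤
      ∑ j ∈ Finset.Ico r (r + k), L.singularValues j := by
  set p := L.leftSingularVector with hp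
  set q := L.rightSingularVector with hq
  let w : ℕ → ℝ := fun j =>
    (∑ i ∈ Finset.range k, inner ℝ (v i) (q j) ^ 2 + ∑ i ∈ Finset.range k, inner ℝ (u i) (p j) ^ 2)
      / 2
  have hp' : IsBessel p := L.isBessel_leftSingularVector
  have hq' : IsBessel q := L.isBessel_rightSingularVector
  have key := sum_mul_le_sum_Ico_of_antitone (w := w) L.singularValues_antitone
    L.singularValues_nonneg (r := r) (k := k) (N := N) (fun i => by positivity)
    (fun i => by
      have h1 := (hv (Finset.range k) (q i)).trans (hq'.norm_sq_le_one i)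
      have h2 := (hu (Finset.range k) (p i)).trans (hp'.norm_sq_le_one i)
      simp only [w]; linarith)
    (by
      simp only [w]
      rw [← Finset.sum_div, Finset.sum_add_distrib]
      linarith [hv.sum_sum_sq_inner_le hq' (Finset.Ico r (r + k + N)) k,
        hu.sum_sum_sq_inner_le hp' (Finset.Ico r (r + k + N)) k])
  refine le_trans ?_ key
  simp only [LinearMap.svdPart_apply, inner_sum]
  rw [Finset.sum_comm]
  refine Finset.sum_le_sum fun j _ => ?_
  simp only [w]
  rw [← Finset.sum_add_distrib, ← mul_div_assoc, Finset.mul_sum, Finset.sum_div]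
  refine Finset.sum_le_sum fun i _ => ?_
  rw [← L.singularValues_smul_leftSingularVector, real_inner_smul_right, real_inner_smul_right,
    ← hp, ← hq, real_inner_comm (v i) (q j)]
  nlinarith [mul_nonneg (L.singularValues_nonneg j)
    (sq_nonneg (inner ℝ (v i) (q j) - inner ℝ (u i) (p j)))]

theorem exists_threshold_index {s : ℕ → ℝ} (hs : Antitone s) (c : ℝ) (k : ℕ) :
    ∃ r ≤ k, (∀ i < r, c ≤ s i) ∧ ∀ i, r ≤ i → i < k → s i ≤ c := by
  induction k with
  | zero => exact ⟨0, le_rfl, by simp, by simp⟩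
  | succ k ih =>
    obtain ⟨r, hr, h1, h2⟩ := ih
    by_cases h : c ≤ s k
    · exact ⟨k + 1, le_rfl, fun i hi => h.trans (hs (by omega)), fun i h3 h4 => by omega⟩
    · refine ⟨r, by omega, h1, fun i h3 h4 => ?_⟩
      rcases Nat.lt_succ_iff_lt_or_eq.mp h4 with h5 | rfl
      · exact h2 i h3 h5
      · exact (not_le.mp h).le

/-- Subadditivity of the truncated partial sums `∑_{i < k} min (σᵢ, c)`. The singular vectors of `A`
and `B` with singular value above `c` make up a perturbation of rank `rA + rB`, which costs `c` per
rank by Weyl's inequality; what is left is controlled by Ky Fan's inequality. -/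
theorem LinearMap.sum_min_singularValues_add_le (A B : E →ₗ[ℝ] F) {c : ℝ} (hc : 0 ≤ c) (k : ℕ) :
    ∑ i ∈ Finset.range k, min ((A + B).singularValues i) c ≤
      ∑ i ∈ Finset.range k, min (A.singularValues i) c +
        ∑ i ∈ Finset.range k, min (B.singularValues i) c := by
  have hsplit : ∀ (s : ℕ → ℝ) (r : ℕ), r ≤ k → (∀ i < r, c ≤ s i) →
      (∀ i, r ≤ i → i < k → s i ≤ c) →
      ∑ i ∈ Finset.range k, min (s i) c = r * c + ∑ i ∈ Finset.Ico r k, s i := by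
    intro s r hr h1 h2
    rw [← Finset.sum_range_add_sum_Ico _ hr]
    congr 1
    · rw [Finset.sum_congr rfl fun i hi => min_eq_right (h1 i (Finset.mem_range.mp hi))]
      simp
    · exact Finset.sum_congr rfl fun i hi =>
        min_eq_left (h2 i (Finset.mem_Ico.mp hi).1 (Finset.mem_Ico.mp hi).2)
  obtain ⟨rA, hrA, hA1, hA2⟩ := exists_threshold_index A.singularValues_antitone c k
  obtain ⟨rB, hrB, hB1, hB2⟩ := exists_threshold_index B.singularValues_antitone c k
  rw [hsplit _ rA hrA hA1 hA2, hsplit _ rB hrB hB1 hB2]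
  have hA0 : ∀ a b, 0 ≤ ∑ i ∈ Finset.Ico a b, A.singularValues i := fun a b =>
    Finset.sum_nonneg fun i _ => A.singularValues_nonneg i
  have hB0 : ∀ a b, 0 ≤ ∑ i ∈ Finset.Ico a b, B.singularValues i := fun a b =>
    Finset.sum_nonneg fun i _ => B.singularValues_nonneg i
  rcases le_total k (rA + rB) with hk | hk
  · have h1 : ∑ i ∈ Finset.range k, min ((A + B).singularValues i) c ≤ k * c := by
      refine (Finset.sum_le_sum fun i _ => min_le_right _ _).trans ?_
      simp
    have h2 : (k : ℝ) ≤ rA + rB := by exact_mod_cast hk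
    nlinarith [hA0 rA k, hB0 rB k]
  obtain ⟨l, rfl⟩ := Nat.exists_eq_add_of_le hk
  set n := finrank ℝ E
  set Z := A.svdPart (Finset.Ico rA (rA + l + n)) + B.svdPart (Finset.Ico rB (rB + l + n)) with hZ
  set Y := A.svdPart (Finset.range rA) + B.svdPart (Finset.range rB) with hY
  have hdec : ∀ (L : E →ₗ[ℝ] F) (r : ℕ),
      L = L.svdPart (Finset.range r) + L.svdPart (Finset.Ico r (r + l + n)) := by
    intro L r
    conv_lhs => rw [← L.svdPart_range (show finrank ℝ E ≤ r + l + n by omega)]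
    rw [LinearMap.svdPart, LinearMap.svdPart, LinearMap.svdPart,
      Finset.sum_range_add_sum_Ico _ (by omega)]
  have hAB : A + B = Z + Y := by
    conv_lhs => rw [hdec A rA, hdec B rB]
    rw [hZ, hY]; abel
  have hrank : finrank ℝ Y.range ≤ rA + rB := by
    refine (Submodule.finrank_mono (LinearMap.range_add_le _ _)).trans
      ((Submodule.finrank_add_le_finrank_add_finrank _ _).trans (add_le_add ?_ ?_))
    · simpa using A.finrank_range_svdPart_le (Finset.range rA)
    · simpa using B.finrank_range_svdPart_le (Finset.range rB)
  have hhead : ∑ i ∈ Finset.range (rA + rB), min ((A + B).singularValues i) c ≤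
      (rA + rB) * c := by
    refine (Finset.sum_le_sum fun i _ => min_le_right _ _).trans ?_
    simp
  have htail : ∑ i ∈ Finset.range l, min ((A + B).singularValues (rA + rB + i)) c ≤
      ∑ i ∈ Finset.range l, Z.singularValues i := by
    refine Finset.sum_le_sum fun i _ => (min_le_left _ _).trans ?_
    rw [hAB, add_comm (rA + rB) i]
    refine LinearMap.singularValues_le_of_forall_apply_eq_zero hrank (fun x hx => ?_) i
    rw [LinearMap.add_apply, hx, add_zero]
  have hKF : ∑ i ∈ Finset.range l, Z.singularValues i ≤
      ∑ j ∈ Finset.Ico rA (rA + l), A.singularValues j +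
        ∑ j ∈ Finset.Ico rB (rB + l), B.singularValues j := by
    refine le_trans (le_of_eq ?_) (add_le_add
      (A.sum_inner_svdPart_le Z.isBessel_leftSingularVector Z.isBessel_rightSingularVector rA l n)
      (B.sum_inner_svdPart_le Z.isBessel_leftSingularVector Z.isBessel_rightSingularVector rB l n))
    rw [← Finset.sum_add_distrib]
    refine Finset.sum_congr rfl fun i _ => ?_
    rw [← Z.inner_leftSingularVector_apply, ← inner_add_right, ← LinearMap.add_apply]
  have hAm : ∑ j ∈ Finset.Ico rA (rA + l), A.singularValues j ≤
      ∑ j ∈ Finset.Ico rA (rA + rB + l), A.singularValues j :=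
    Finset.sum_le_sum_of_subset_of_nonneg (Finset.Ico_subset_Ico le_rfl (by omega))
      fun i _ _ => A.singularValues_nonneg i
  have hBm : ∑ j ∈ Finset.Ico rB (rB + l), B.singularValues j ≤
      ∑ j ∈ Finset.Ico rB (rA + rB + l), B.singularValues j :=
    Finset.sum_le_sum_of_subset_of_nonneg (Finset.Ico_subset_Ico le_rfl (by omega))
      fun i _ _ => B.singularValues_nonneg i
  rw [Finset.sum_range_add]
  linarith

end KyFan

/-! ### The fraction function as a mixture of truncations -/

section FractionFunction

open TrAMRM

theorem fractionFun_zero (a : ℝ) : fractionFun a 0 = 0 := by simp [fractionFun]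

theorem fractionFun_nonneg {a : ℝ} (ha : 0 < a) (t : ℝ) : 0 ≤ fractionFun a t := by
  unfold fractionFun; positivity

theorem fractionFun_mono {a : ℝ} (ha : 0 < a) {s t : ℝ} (hs : 0 ≤ s) (hst : s ≤ t) :
    fractionFun a s ≤ fractionFun a t := by
  have ht := hs.trans hst
  rw [fractionFun, fractionFun, abs_of_nonneg hs, abs_of_nonneg ht,
    div_le_div_iff₀ (by positivity) (by positivity)]
  nlinarith

/-- `ρ_a(t) / t` decreases in `t`. -/
theorem fractionFun_mul_le {a : ℝ} (ha : 0 < a) {s t : ℝ} (hs : 0 ≤ s) (hst : s ≤ t) :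
    fractionFun a t * s ≤ fractionFun a s * t := by
  have ht := hs.trans hst
  rw [fractionFun, fractionFun, abs_of_nonneg hs, abs_of_nonneg ht, div_mul_eq_mul_div,
    div_mul_eq_mul_div, div_le_div_iff₀ (by positivity) (by positivity)]
  have : 0 ≤ a * a * (s * t) * (t - s) := by
    have := sub_nonneg.mpr hst; positivity
  nlinarith

/-- The concave function `ρ_a` is, on `[0, M]`, a mixture of the functions `min · c` with the weight
`-ρ_a''(c)`, plus a linear function of slope `ρ_a'(M)`. -/
theorem fractionFun_eq_integral {a : ℝ} (ha : 0 < a) {t M : ℝ} (ht : 0 ≤ t) (htM : t ≤ M) :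
    fractionFun a t =
      (∫ c in (0 : ℝ)..M, min t c * (2 * a ^ 2 / (1 + a * c) ^ 3)) + t * (a / (1 + a * M) ^ 2) := by
  have hpos : ∀ c : ℝ, 0 ≤ c → 0 < 1 + a * c := fun c hc => by positivity
  have hcont : ∀ x y : ℝ, 0 ≤ x → x ≤ y → ∀ g : ℝ → ℝ, Continuous g →
      IntervalIntegrable (fun c => g c * (2 * a ^ 2 / (1 + a * c) ^ 3)) MeasureTheory.volume x y := by
    intro x y hx hxy g hg
    refine ContinuousOn.intervalIntegrable fun c hc => ContinuousAt.continuousWithinAt ?_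
    rw [Set.uIcc_of_le hxy] at hc
    have := (hpos c (hx.trans hc.1)).ne'
    fun_prop (disch := positivity)
  have hlin : ∀ c : ℝ, HasDerivAt (fun c : ℝ => 1 + a * c) a c := fun c => by
    simpa using ((hasDerivAt_id c).const_mul a).const_add 1
  have h1 : ∫ c in (0 : ℝ)..t, min t c * (2 * a ^ 2 / (1 + a * c) ^ 3) =
      (a * t) ^ 2 / (1 + a * t) ^ 2 := by
    have hd : ∀ c ∈ Set.uIcc 0 t, HasDerivAt (fun c : ℝ => (a * c) ^ 2 / (1 + a * c) ^ 2)
        (c * (2 * a ^ 2 / (1 + a * c) ^ 3)) c := by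
      intro c hc
      rw [Set.uIcc_of_le ht] at hc
      have hne := (hpos c hc.1).ne'
      have h := ((((hasDerivAt_id c).const_mul a).pow 2).div ((hlin c).pow 2) (pow_ne_zero 2 hne))
      refine (h.congr_deriv ?_).congr_of_eventuallyEq (Filter.Eventually.of_forall fun _ => rfl)
      simp only [id, Pi.pow_apply]
      field_simp
      ring
    rw [intervalIntegral.integral_congr (g := fun c => c * (2 * a ^ 2 / (1 + a * c) ^ 3)),
      intervalIntegral.integral_eq_sub_of_hasDerivAt hd (hcont 0 t le_rfl ht _ continuous_id)]
    · simp
    · intro c hc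
      rw [Set.uIcc_of_le ht] at hc
      simp only [min_eq_right hc.2]
  have h2 : ∫ c in t..M, min t c * (2 * a ^ 2 / (1 + a * c) ^ 3) =
      t * (a / (1 + a * t) ^ 2 - a / (1 + a * M) ^ 2) := by
    have hd : ∀ c ∈ Set.uIcc t M, HasDerivAt (fun c : ℝ => -(t * (a / (1 + a * c) ^ 2)))
        (t * (2 * a ^ 2 / (1 + a * c) ^ 3)) c := by
      intro c hc
      rw [Set.uIcc_of_le htM] at hc
      have hne := (hpos c (ht.trans hc.1)).ne'
      have h := ((((hasDerivAt_const c a).div ((hlin c).pow 2) (pow_ne_zero 2 hne))).const_mul t).neg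
      refine (h.congr_deriv ?_).congr_of_eventuallyEq (Filter.Eventually.of_forall fun _ => rfl)
      simp only [Pi.pow_apply]
      field_simp
      ring
    rw [intervalIntegral.integral_congr (g := fun c => t * (2 * a ^ 2 / (1 + a * c) ^ 3)),
      intervalIntegral.integral_eq_sub_of_hasDerivAt hd (hcont t M ht htM _ continuous_const)]
    · ring
    · intro c hc
      rw [Set.uIcc_of_le htM] at hc
      simp only [min_eq_left hc.1]
  rw [← intervalIntegral.integral_add_adjacent_intervals
    (hcont 0 t le_rfl ht _ (by fun_prop)) (hcont t M ht htM _ (by fun_prop)), h1, h2, fractionFun,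
    abs_of_nonneg ht]
  have := (hpos t ht).ne'
  have := (hpos M (ht.trans htM)).ne'
  field_simp
  ring

/-- An inequality between sums of truncations `min · c` passes to the concave function `ρ_a`. -/
theorem sum_fractionFun_le_of_sum_min_le {ι : Type*} {a : ℝ} (ha : 0 < a) (S : Finset ι)
    {x y z : ι → ℝ} (hx : ∀ i, 0 ≤ x i) (hy : ∀ i, 0 ≤ y i) (hz : ∀ i, 0 ≤ z i)
    (h : ∀ c, 0 ≤ c →
      ∑ i ∈ S, min (x i) c ≤ ∑ i ∈ S, min (y i) c + ∑ i ∈ S, min (z i) c) :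
    ∑ i ∈ S, fractionFun a (x i) ≤
      ∑ i ∈ S, fractionFun a (y i) + ∑ i ∈ S, fractionFun a (z i) := by
  set M := ∑ i ∈ S, (x i + y i + z i) with hM
  have hM0 : 0 ≤ M := Finset.sum_nonneg fun i _ => add_nonneg (add_nonneg (hx i) (hy i)) (hz i)
  have hle : ∀ i ∈ S, x i + y i + z i ≤ M := fun i hi =>
    Finset.single_le_sum (f := fun i => x i + y i + z i)
      (fun i _ => add_nonneg (add_nonneg (hx i) (hy i)) (hz i)) hi
  have hint : ∀ g : ℝ → ℝ, Continuous g → IntervalIntegrable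
      (fun c => g c * (2 * a ^ 2 / (1 + a * c) ^ 3)) MeasureTheory.volume 0 M := by
    intro g hg
    refine ContinuousOn.intervalIntegrable fun c hc => ContinuousAt.continuousWithinAt ?_
    rw [Set.uIcc_of_le hM0] at hc
    have : 0 < 1 + a * c := by have := hc.1; positivity
    have := this.ne'
    fun_prop (disch := positivity)
  have hrep : ∀ w : ι → ℝ, (∀ i, 0 ≤ w i) → (∀ i ∈ S, w i ≤ M) →
      ∑ i ∈ S, fractionFun a (w i) =
        (∫ c in (0 : ℝ)..M, (∑ i ∈ S, min (w i) c) * (2 * a ^ 2 / (1 + a * c) ^ 3)) +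
          (∑ i ∈ S, min (w i) M) * (a / (1 + a * M) ^ 2) := by
    intro w hw hwM
    simp only [Finset.sum_mul]
    rw [intervalIntegral.integral_finsetSum fun i _ => hint _ (by fun_prop),
      ← Finset.sum_add_distrib]
    refine Finset.sum_congr rfl fun i hi => ?_
    rw [fractionFun_eq_integral ha (hw i) (hwM i hi), min_eq_left (hwM i hi)]
  rw [hrep x hx fun i hi => by linarith [hle i hi, hy i, hz i],
    hrep y hy fun i hi => by linarith [hle i hi, hx i, hz i],
    hrep z hz fun i hi => by linarith [hle i hi, hx i, hy i], add_add_add_comm,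
    ← intervalIntegral.integral_add (hint _ (by fun_prop)) (hint _ (by fun_prop)), ← add_mul]
  refine add_le_add ?_ (mul_le_mul_of_nonneg_right (h M hM0) (by positivity))
  simp only [← add_mul]
  refine intervalIntegral.integral_mono_on hM0 (hint _ (by fun_prop)) (hint _ (by fun_prop)) ?_
  intro c hc
  have : 0 < 1 + a * c := by have := hc.1; positivity
  exact mul_le_mul_of_nonneg_right (h c hc.1) (by positivity)

end FractionFunction

/-! ### Heads, tails and blocks of decreasing sequences -/

section Sequences

open TrAMRM

/-- If the tail of a decreasing sequence is dominated by its head after `ρ_a` is applied, then so it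
is without `ρ_a`: since `ρ_a(t) / t` decreases, passing from `ρ_a(t)` to the multiple of `t` that
agrees with it at `s (p - 1)` raises the head and lowers the tail. -/
theorem sum_tail_le_sum_head_of_fractionFun {a : ℝ} (ha : 0 < a) {s : ℕ → ℝ} (hs : Antitone s)
    (hs0 : ∀ i, 0 ≤ s i) {p l : ℕ} (hp : 0 < p)
    (h : ∑ i ∈ Finset.range l, fractionFun a (s (p + i)) ≤
      ∑ i ∈ Finset.range p, fractionFun a (s i)) :
    ∑ i ∈ Finset.range l, s (p + i) ≤ ∑ i ∈ Finset.range p, s i := by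
  rcases (hs0 (p - 1)).eq_or_lt' with h0 | hpos
  · have : ∀ i, s (p + i) = 0 := fun i =>
      le_antisymm (h0 ▸ hs (show p - 1 ≤ p + i by omega)) (hs0 _)
    simp only [this, Finset.sum_const_zero]
    exact Finset.sum_nonneg fun i _ => hs0 i
  have hfpos : 0 < fractionFun a (s (p - 1)) := by
    rw [fractionFun, abs_of_pos hpos]; positivity
  refine le_of_mul_le_mul_left ?_ hfpos
  calc fractionFun a (s (p - 1)) * ∑ i ∈ Finset.range l, s (p + i)
      ≤ (∑ i ∈ Finset.range l, fractionFun a (s (p + i))) * s (p - 1) := by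
        rw [Finset.mul_sum, Finset.sum_mul]
        exact Finset.sum_le_sum fun i _ => fractionFun_mul_le ha (hs0 _) (hs (by omega))
    _ ≤ (∑ i ∈ Finset.range p, fractionFun a (s i)) * s (p - 1) :=
        mul_le_mul_of_nonneg_right h hpos.le
    _ ≤ fractionFun a (s (p - 1)) * ∑ i ∈ Finset.range p, s i := by
        rw [Finset.mul_sum, Finset.sum_mul]
        refine Finset.sum_le_sum fun i hi => fractionFun_mul_le ha (hs0 _) (hs ?_)
        have := Finset.mem_range.mp hi
        omega

/-- For a decreasing sequence the `ℓ²`-norm of a block of length `K` is at most `1 / √K` times the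
`ℓ¹`-norm of the block before it. -/
theorem mul_sum_sq_le_sq_sum_of_antitone {s : ℕ → ℝ} (hs : Antitone s) (hs0 : ∀ i, 0 ≤ s i)
    (q K : ℕ) :
    K * ∑ i ∈ Finset.Ico (q + K) (q + K + K), s i ^ 2 ≤
      (∑ i ∈ Finset.Ico q (q + K), s i) ^ 2 := by
  have h1 : ∑ i ∈ Finset.Ico (q + K) (q + K + K), s i ^ 2 ≤ K * s (q + K) ^ 2 := by
    refine (Finset.sum_le_sum (g := fun _ => s (q + K) ^ 2) fun i hi =>
      pow_le_pow_left₀ (hs0 i) (hs (Finset.mem_Ico.mp hi).1) 2).trans ?_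
    simp
  have h2 : K * s (q + K) ≤ ∑ i ∈ Finset.Ico q (q + K), s i := by
    refine le_trans ?_ (Finset.sum_le_sum (f := fun _ => s (q + K)) fun i hi =>
      hs (Finset.mem_Ico.mp hi).2.le)
    simp
  calc (K : ℝ) * ∑ i ∈ Finset.Ico (q + K) (q + K + K), s i ^ 2
      ≤ K * (K * s (q + K) ^ 2) := mul_le_mul_of_nonneg_left h1 (Nat.cast_nonneg _)
    _ = (K * s (q + K)) ^ 2 := by ring
    _ ≤ _ := pow_le_pow_left₀ (mul_nonneg (Nat.cast_nonneg _) (hs0 _)) h2 2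

theorem sum_Ico_eq_sum_sum_Ico {M : Type*} [AddCommMonoid M] (g : ℕ → M) (q K J : ℕ) :
    ∑ i ∈ Finset.Ico q (q + J * K), g i =
      ∑ j ∈ Finset.range J, ∑ i ∈ Finset.Ico (q + j * K) (q + j * K + K), g i := by
  induction J with
  | zero => simp
  | succ J ih =>
    rw [Finset.sum_range_succ, ← ih, Finset.sum_Ico_consecutive _ (by omega) (by omega),
      Nat.succ_mul, add_assoc]

end Sequences

/-! ### Singular values of matrices -/

section Matrices

open TrAMRM

variable {m n : ℕ}

theorem Matrix.finrank_range_toEuclideanLin (X : Matrix (Fin m) (Fin n) ℝ) :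
    finrank ℝ (Matrix.toEuclideanLin X).range = X.rank := by
  rw [Matrix.toEuclideanLin, Matrix.toLpLin_eq_toLin]
  exact (Matrix.rank_eq_finrank_range_toLin X _ _).symm

theorem singularValue_nonneg (X : Matrix (Fin m) (Fin n) ℝ) (i : ℕ) : 0 ≤ singularValue X i :=
  LinearMap.singularValues_nonneg _ i

theorem singularValue_antitone (X : Matrix (Fin m) (Fin n) ℝ) : Antitone (singularValue X) :=
  LinearMap.singularValues_antitone _

theorem singularValue_eq_zero_iff {X : Matrix (Fin m) (Fin n) ℝ} {i : ℕ} :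
    singularValue X i = 0 ↔ X.rank ≤ i := by
  rw [← Matrix.finrank_range_toEuclideanLin]
  exact LinearMap.singularValues_eq_zero_iff_le_finrank_range _

theorem penalty_eq_sum_range {a : ℝ} (X : Matrix (Fin m) (Fin n) ℝ) {N : ℕ} (hN : X.rank ≤ N) :
    penalty a X = ∑ i ∈ Finset.range N, fractionFun a (singularValue X i) := by
  have h : ∀ M, X.rank ≤ M → ∑ i ∈ Finset.range X.rank, fractionFun a (singularValue X i) =
      ∑ i ∈ Finset.range M, fractionFun a (singularValue X i) := fun M hM => by
    refine Finset.sum_subset (Finset.range_mono hM) fun i _ hi => ?_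
    rw [singularValue_eq_zero_iff.mpr (by simpa using hi), fractionFun_zero]
  rw [penalty, ← h m (by simpa using X.rank_le_height), h N hN]

theorem frobeniusSq_eq_sum_norm_sq {ι : Type*} [Fintype ι] (X : Matrix (Fin m) (Fin n) ℝ)
    (e : OrthonormalBasis ι ℝ (EuclideanSpace ℝ (Fin n))) :
    frobeniusSq X = ∑ k, ‖Matrix.toEuclideanLin X (e k)‖ ^ 2 := by
  have hrow : ∀ i, ∑ j, X i j ^ 2 = ∑ k, (Matrix.toEuclideanLin X (e k) i) ^ 2 := by
    intro i
    have h := e.sum_sq_inner_right (WithLp.toLp 2 (X i))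
    rw [EuclideanSpace.real_norm_sq_eq] at h
    rw [← h]
    refine Finset.sum_congr rfl fun k _ => ?_
    simp [Matrix.toLpLin_apply, Matrix.mulVec, dotProduct, PiLp.inner_apply]
  rw [frobeniusSq, Finset.sum_congr rfl fun i _ => hrow i, Finset.sum_comm]
  simp only [EuclideanSpace.real_norm_sq_eq]

/-- The part of the singular value decomposition of the matrix `X` that belongs to the indices in
`S`. -/
noncomputable def matrixSvdPart (X : Matrix (Fin m) (Fin n) ℝ) (S : Finset ℕ) :
    Matrix (Fin m) (Fin n) ℝ :=
  Matrix.toEuclideanLin.symm ((Matrix.toEuclideanLin X).svdPart S)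

theorem toEuclideanLin_matrixSvdPart (X : Matrix (Fin m) (Fin n) ℝ) (S : Finset ℕ) :
    Matrix.toEuclideanLin (matrixSvdPart X S) = (Matrix.toEuclideanLin X).svdPart S :=
  LinearEquiv.apply_symm_apply _ _

theorem rank_matrixSvdPart_le (X : Matrix (Fin m) (Fin n) ℝ) (S : Finset ℕ) :
    (matrixSvdPart X S).rank ≤ S.card := by
  rw [← Matrix.finrank_range_toEuclideanLin, toEuclideanLin_matrixSvdPart]
  exact LinearMap.finrank_range_svdPart_le _ S

theorem matrixSvdPart_range (X : Matrix (Fin m) (Fin n) ℝ) {N : ℕ} (hN : n ≤ N) :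
    matrixSvdPart X (Finset.range N) = X := by
  rw [matrixSvdPart, LinearMap.svdPart_range _ (by simpa using hN), LinearEquiv.symm_apply_apply]

theorem matrixSvdPart_eq_sum (X : Matrix (Fin m) (Fin n) ℝ) (S : Finset ℕ) :
    matrixSvdPart X S = ∑ i ∈ S, matrixSvdPart X {i} := by
  simp [matrixSvdPart, LinearMap.svdPart]

theorem frobeniusSq_matrixSvdPart (X : Matrix (Fin m) (Fin n) ℝ) (S : Finset ℕ) :
    frobeniusSq (matrixSvdPart X S) = ∑ i ∈ S, singularValue X i ^ 2 := by
  set L := Matrix.toEuclideanLin X with hL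
  have hn : finrank ℝ (EuclideanSpace ℝ (Fin n)) = n := by simp
  rw [frobeniusSq_eq_sum_norm_sq _ (L.isSymmetric_adjoint_comp_self.eigenvectorBasis rfl),
    toEuclideanLin_matrixSvdPart,
    ← L.sum_range_rightSingularVector fun v => ‖L.svdPart S v‖ ^ 2, hn]
  have h : ∀ i, ‖L.svdPart S (L.rightSingularVector i)‖ ^ 2 =
      if i ∈ S then singularValue X i ^ 2 else 0 := by
    intro i
    rw [LinearMap.svdPart_rightSingularVector]
    split_ifs
    · rw [LinearMap.norm_apply_rightSingularVector]; rfl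
    · simp
  rw [Finset.sum_congr rfl fun i _ => h i, Finset.sum_ite_mem, Finset.inter_comm,
    ← Finset.sum_ite_mem]
  refine Finset.sum_congr rfl fun i _ => ?_
  split_ifs with hi
  · rfl
  · have hr : X.rank ≤ i := X.rank_le_width.trans (by simpa using hi)
    rw [singularValue_eq_zero_iff.mpr hr]; simp

/-- The partial sums `∑_{i < k} ρ_a(σᵢ)` are subadditive. -/
theorem sum_fractionFun_singularValue_add_le {a : ℝ} (ha : 0 < a)
    (X Y : Matrix (Fin m) (Fin n) ℝ) (k : ℕ) :
    ∑ i ∈ Finset.range k, fractionFun a (singularValue (X + Y) i) ≤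
      ∑ i ∈ Finset.range k, fractionFun a (singularValue X i) +
        ∑ i ∈ Finset.range k, fractionFun a (singularValue Y i) := by
  refine sum_fractionFun_le_of_sum_min_le ha _ (singularValue_nonneg _) (singularValue_nonneg _)
    (singularValue_nonneg _) fun c hc => ?_
  simp only [singularValue, map_add]
  exact LinearMap.sum_min_singularValues_add_le _ _ hc k

theorem singularValue_add_rank_le (X Y : Matrix (Fin m) (Fin n) ℝ) (i : ℕ) :
    singularValue (Y - X) (i + Y.rank) ≤ singularValue X i := by
  refine LinearMap.singularValues_le_of_forall_apply_eq_zero (Y := Matrix.toEuclideanLin Y)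
    (Matrix.finrank_range_toEuclideanLin Y).le (fun x hx => ?_) i
  rw [map_sub, LinearMap.sub_apply, hx, zero_sub, norm_neg]

/-- If replacing `Y` by `X` does not increase the penalty, then the leading `2 * rank Y` singular
values of the difference dominate the others in the penalty. -/
theorem sum_tail_fractionFun_le_of_penalty_le {a : ℝ} (ha : 0 < a)
    {X Y : Matrix (Fin m) (Fin n) ℝ} (h : penalty a X ≤ penalty a Y) {l : ℕ} (hl : m ≤ l) :
    ∑ i ∈ Finset.range l, fractionFun a (singularValue (Y - X) (2 * Y.rank + i)) ≤
      ∑ i ∈ Finset.range (2 * Y.rank), fractionFun a (singularValue (Y - X) i) := by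
  set r := Y.rank with hr
  have hX : X.rank ≤ r + l := by
    have := X.rank_le_height
    omega
  rw [penalty_eq_sum_range X hX, penalty_eq_sum_range Y hr.symm.le, Finset.sum_range_add] at h
  have hsub := sum_fractionFun_singularValue_add_le ha X (Y - X) r
  rw [add_sub_cancel] at hsub
  have hweyl : ∑ i ∈ Finset.range l, fractionFun a (singularValue (Y - X) (2 * r + i)) ≤
      ∑ i ∈ Finset.range l, fractionFun a (singularValue X (r + i)) := by
    refine Finset.sum_le_sum fun i _ => fractionFun_mono ha (singularValue_nonneg _ _) ?_
    have := singularValue_add_rank_le X Y (r + i)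
    rwa [← hr, show r + i + r = 2 * r + i by omega] at this
  have hmono : ∑ i ∈ Finset.range r, fractionFun a (singularValue (Y - X) i) ≤
      ∑ i ∈ Finset.range (2 * r), fractionFun a (singularValue (Y - X) i) :=
    Finset.sum_le_sum_of_subset_of_nonneg (Finset.range_mono (by omega))
      fun i _ _ => fractionFun_nonneg ha _
  linarith

end Matrices

/-! ### The null space argument -/

section RestrictedIsometry

open TrAMRM

variable {m n d : ℕ}

theorem one_add_nonneg_of_mem_ricSet (hm : 0 < m) (hn : 0 < n)
    {𝒜 : Matrix (Fin m) (Fin n) ℝ →ₗ[ℝ] EuclideanSpace ℝ (Fin d)} {r : ℕ} (hr : 1 ≤ r) {δ : ℝ}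
    (hδ : δ ∈ ricSet 𝒜 r) : 0 ≤ 1 + δ := by
  have hpos : frobeniusSq (Matrix.single (⟨0, hm⟩ : Fin m) (⟨0, hn⟩ : Fin n) (1 : ℝ)) = 1 := by
    simp [frobeniusSq, Matrix.single_apply, ite_and]
  have hrk : (Matrix.single (⟨0, hm⟩ : Fin m) (⟨0, hn⟩ : Fin n) (1 : ℝ)).rank ≤ r := by
    rw [Matrix.single_eq_single_vecMulVec_single]
    exact (Matrix.rank_vecMulVec_le _ _).trans hr
  have h := (hδ _ hrk).2
  rw [hpos, mul_one] at h
  exact (sq_nonneg _).trans h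

/-- The null space argument: a matrix in the kernel of `𝒜` whose leading `p` singular values
dominate the others in `ℓ¹` is zero. The singular values after the first `p` are cut into blocks of
length `K`; the first block is kept together with the head, and the others are estimated by the
`ℓ¹`-norms of their predecessors. -/
theorem eq_zero_of_sum_tail_le_sum_head {p K : ℕ} (hp : 0 < p) {δ δ' : ℝ} (hδ0 : 0 ≤ 1 + δ)
    (hδδ : 0 < (K : ℝ) / p * (1 - δ') - (1 + δ))
    {𝒜 : Matrix (Fin m) (Fin n) ℝ →ₗ[ℝ] EuclideanSpace ℝ (Fin d)} (hδ : δ ∈ ricSet 𝒜 K)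
    (hδ' : δ' ∈ ricSet 𝒜 (p + K)) {R : Matrix (Fin m) (Fin n) ℝ} (hR : 𝒜 R = 0)
    (h : ∀ l, m ≤ l →
      ∑ i ∈ Finset.range l, singularValue R (p + i) ≤ ∑ i ∈ Finset.range p, singularValue R i) :
    R = 0 := by
  set s := singularValue R with hs
  have hs0 : ∀ i, 0 ≤ s i := singularValue_nonneg R
  have hanti : Antitone s := singularValue_antitone R
  have hK : 0 < K := by
    rcases Nat.eq_zero_or_pos K with rfl | h0
    · simp at hδδ; linarith
    · exact h0
  have hKR : (0 : ℝ) < K := by exact_mod_cast hK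
  have hpR : (0 : ℝ) < p := by exact_mod_cast hp
  set J := m + n with hJ
  have hJK : J ≤ J * K := Nat.le_mul_of_pos_right _ hK
  let B : ℕ → Matrix (Fin m) (Fin n) ℝ := fun j =>
    matrixSvdPart R (Finset.Ico (p + K + j * K) (p + K + j * K + K))
  set H := matrixSvdPart R (Finset.range (p + K)) with hH
  have hdec : R = H + ∑ j ∈ Finset.range J, B j := by
    conv_lhs => rw [← matrixSvdPart_range R (show n ≤ p + K + J * K by omega)]
    simp only [hH, B]
    rw [matrixSvdPart_eq_sum, ← Finset.sum_range_add_sum_Ico _ (show p + K ≤ p + K + J * K by omega),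
      ← matrixSvdPart_eq_sum, sum_Ico_eq_sum_sum_Ico]
    simp only [← matrixSvdPart_eq_sum]
  have hAH : 𝒜 H = -∑ j ∈ Finset.range J, 𝒜 (B j) := by
    have h1 := hR
    rw [hdec, map_add, map_sum] at h1
    exact eq_neg_of_add_eq_zero_left h1
  have hblock : ∀ j, √K * ‖𝒜 (B j)‖ ≤
      √(1 + δ) * ∑ i ∈ Finset.Ico (p + j * K) (p + j * K + K), s i := by
    intro j
    have hrk : (B j).rank ≤ K := by
      simpa using rank_matrixSvdPart_le R (Finset.Ico (p + K + j * K) (p + K + j * K + K))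
    have h1 := (hδ _ hrk).2
    rw [frobeniusSq_matrixSvdPart] at h1
    have h2 := mul_sum_sq_le_sq_sum_of_antitone hanti hs0 (p + j * K) K
    rw [show p + j * K + K = p + K + j * K by omega] at h2
    rw [show p + j * K + K = p + K + j * K by omega]
    refine le_of_sq_le_sq ?_ (mul_nonneg (Real.sqrt_nonneg _) (Finset.sum_nonneg fun i _ => hs0 i))
    rw [mul_pow, mul_pow, Real.sq_sqrt hKR.le, Real.sq_sqrt hδ0]
    calc (K : ℝ) * ‖𝒜 (B j)‖ ^ 2 ≤ K * ((1 + δ) * _) := mul_le_mul_of_nonneg_left h1 hKR.le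
      _ = (1 + δ) * (K * _) := by ring
      _ ≤ _ := mul_le_mul_of_nonneg_left h2 hδ0
  have hsum : √K * ‖𝒜 H‖ ≤ √(1 + δ) * ∑ i ∈ Finset.range p, s i := by
    calc √K * ‖𝒜 H‖ ≤ √K * ∑ j ∈ Finset.range J, ‖𝒜 (B j)‖ := by
          rw [hAH, norm_neg]
          exact mul_le_mul_of_nonneg_left (norm_sum_le _ _) (Real.sqrt_nonneg _)
      _ ≤ √(1 + δ) * ∑ i ∈ Finset.Ico p (p + J * K), s i := by
          rw [sum_Ico_eq_sum_sum_Ico, Finset.mul_sum, Finset.mul_sum]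
          exact Finset.sum_le_sum fun j _ => hblock j
      _ ≤ _ := by
          refine mul_le_mul_of_nonneg_left ?_ (Real.sqrt_nonneg _)
          rw [Finset.sum_Ico_eq_sum_range, Nat.add_sub_cancel_left]
          exact h _ (by omega)
  set G := ∑ i ∈ Finset.range (p + K), s i ^ 2 with hG
  have hlow : (1 - δ') * G ≤ ‖𝒜 H‖ ^ 2 := by
    have h1 := (hδ' H (by simpa using rank_matrixSvdPart_le R (Finset.range (p + K)))).1
    rwa [hH, frobeniusSq_matrixSvdPart] at h1
  have hup : K * ‖𝒜 H‖ ^ 2 ≤ (1 + δ) * (p * G) := by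
    have h1 := pow_le_pow_left₀ (mul_nonneg (Real.sqrt_nonneg _) (norm_nonneg _)) hsum 2
    rw [mul_pow, mul_pow, Real.sq_sqrt hKR.le, Real.sq_sqrt hδ0] at h1
    refine h1.trans (mul_le_mul_of_nonneg_left ?_ hδ0)
    have h2 := sq_sum_le_card_mul_sum_sq (s := Finset.range p) (f := s)
    rw [Finset.card_range] at h2
    refine h2.trans (mul_le_mul_of_nonneg_left ?_ hpR.le)
    exact Finset.sum_le_sum_of_subset_of_nonneg (Finset.range_mono (by omega))
      fun i _ _ => sq_nonneg _
  have hG0 : G ≤ 0 := by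
    have h1 : (K : ℝ) / p * (1 - δ') * G ≤ (1 + δ) * G := by
      have h2 := (mul_le_mul_of_nonneg_left hlow hKR.le).trans hup
      calc (K : ℝ) / p * (1 - δ') * G = K * ((1 - δ') * G) / p := by ring
        _ ≤ (1 + δ) * (p * G) / p := div_le_div_of_nonneg_right h2 hpR.le
        _ = (1 + δ) * G := by field_simp
    by_contra! h3
    nlinarith
  have hs00 : s 0 = 0 := by
    have h1 : s 0 ^ 2 ≤ G := Finset.single_le_sum (f := fun i => s i ^ 2)
      (fun i _ => sq_nonneg _) (Finset.mem_range.mpr (by omega))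
    exact pow_eq_zero_iff (two_ne_zero) |>.mp (le_antisymm (h1.trans hG0) (sq_nonneg _))
  have hrank : finrank ℝ (Matrix.toEuclideanLin R).range = 0 := by
    rw [Matrix.finrank_range_toEuclideanLin]
    exact Nat.le_zero.mp (singularValue_eq_zero_iff.mp hs00)
  rw [Submodule.finrank_eq_zero, LinearMap.range_eq_bot] at hrank
  exact (LinearEquiv.map_eq_zero_iff _).mp hrank

end RestrictedIsometry

theorem theorem3 (T K : ℕ) (hT : 1 ≤ T) (hK : 2 * T < K) (δK δTK : ℝ)
    (hδ : 0 < (K : ℝ) / (2 * (T : ℝ)) * (1 - δTK) - (1 + δK)) :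
    ∃ aStar : ℝ, 1 < aStar ∧
      ∀ (m n d : ℕ) (𝒜 : Matrix (Fin m) (Fin n) ℝ →ₗ[ℝ] EuclideanSpace ℝ (Fin d))
        (b : EuclideanSpace ℝ (Fin d)) (X₀ : Matrix (Fin m) (Fin n) ℝ),
        TrAMRM.ric 𝒜 K = δK →
        TrAMRM.ric 𝒜 (2 * T + K) = δTK →
        TrAMRM.IsAMRMSolution 𝒜 b X₀ →
        X₀.rank = T →
        ∀ a : ℝ, 1 < a → a < aStar →
          ∀ Xstar : Matrix (Fin m) (Fin n) ℝ,
            TrAMRM.IsTrAMRMSolution 𝒜 b a Xstar → Xstar = X₀ := by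
  -- The argument works for every `a > 0`, so any number above `1` serves as the bound.
  refine ⟨2, one_lt_two, ?_⟩
  intro m n d 𝒜 b X₀ hδK hδTK hX₀ hrank a ha _ Xstar hXstar
  have ha0 : 0 < a := one_pos.trans ha
  have hm : 0 < m := by have := X₀.rank_le_height; omega
  have hn : 0 < n := by have := X₀.rank_le_width; omega
  have hmemK := (TrAMRM.isLeast_ric hm hn 𝒜 (show 1 ≤ K by omega)).1
  have hmemTK := (TrAMRM.isLeast_ric hm hn 𝒜 (show 1 ≤ 2 * T + K by omega)).1
  rw [hδK] at hmemK
  rw [hδTK] at hmemTK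
  have hker : 𝒜 (X₀ - Xstar) = 0 := by rw [map_sub, hX₀.1, hXstar.1, sub_self]
  have hzero : X₀ - Xstar = 0 := by
    refine eq_zero_of_sum_tail_le_sum_head (p := 2 * T) (by omega)
      (one_add_nonneg_of_mem_ricSet hm hn (by omega) hmemK) (by exact_mod_cast hδ) hmemK hmemTK hker
      fun l hl => ?_
    refine sum_tail_le_sum_head_of_fractionFun ha0 (singularValue_antitone _)
      (singularValue_nonneg _) (by omega) ?_
    rw [← hrank]
    exact sum_tail_fractionFun_le_of_penalty_le ha0 (hXstar.2 X₀ hX₀.1) hl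
  exact (sub_eq_zero.mp hzero).symm
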